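/- Let $f:\mathbb C^2\to\mathbb C^2$ be a polynomial diffeomorphism whose dynamical degree $d(f)=\lim_{n\to\infty}(\deg f^n)^{1/n}$ is greater than $1$ (here $\deg$ is the maximum of the degrees of the coordinate polynomials). Let $K^{\pm}$ be the set of points whose orbit under $f^{\pm1}$ is bounded, and let $J=\partial K^+\cap\partial K^-$ be the Julia set. On $\mathbb C^2=\mathbb R^4$ use the norm $\|x\|_\infty=\max_{i}\max(|\operatorname{Re}x_i|,|\operatorname{Im}x_i|)$; a closed box is a closed ball of positive radius in this norm, and $\mathcal N(B,\delta)$ is the $\delta$-neighborhood of $B$ in this norm. A box chain model $\Gamma$ of $f$ on $J$ is a strongly connected directed graph whose vertices are finitely many closed boxes $B_1,\dots,B_N$ with pairwise disjoint interiors and $J\subset\bigcup_k B_k$, such that for some $\delta>0$ there is an edge $(k,j)$ whenever $f(B_k)\cap\mathcal N(B_j,\delta)\neq\emptyset$ (further edges are allowed). It is box hyperbolic if there are nondegenerate indefinite Hermitian forms $Q_k:\mathbb C^2\to\mathbb R$, $1\le k\le N$, such that, with $C^u_k=\{w: Q_k(w)\ge 0\}$ and $C^s_k=\mathbb C^2\setminus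 C^u_k$, for every edge $(k,j)$ and every $z\in B_k$: 1. if $w\in C^u_k$ and $w\ne0$, then $D_zf(w)\in C^u_j$ and $Q_j(D_zf(w))>Q_k(w)$; 2. if $v\in C^s_j$, then $[D_zf]^{-1}(v)\in C^s_k$ and $-Q_k([D_zf]^{-1}(v))>-Q_j(v)$. Theorem. If $\Gamma$ is a box chain model of $f$ on $J$ and $\Gamma$ is box hyperbolic, then $f$ is hyperbolic on $J$; that is, $J$ is compact, $f(J)=J$, and there are a splitting $T_x\mathbb C^2=E^s_x\oplus E^u_x$ into complex subspaces, varying continuously with $x\in J$, a norm $\|\cdot\|_x$ on $T_x\mathbb C^2$, continuous for $x\in J$, and a constant $\lambda>1$ such that for all $x\in J$: $D_xf(E^s_x)=E^s_{f(x)}$ and $D_xf(E^u_x)=E^u_{f(x)}$; $\|D_xf(w)\|_{f(x)}\ge\lambda\|w\|_x$ for $w\in E^u_x$; and $\|D_xf^{-1}(w)\|_{f^{-1}(x)}\ge\lambda\|w\|_x$ for $w\in E^s_x$. -/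

import Mathlib

open scoped ContDiff Topology Matrix

noncomputable section

namespace BoxHyp

/-- The complex plane `ℂ²`; it is also identified with each of its tangent spaces. -/
abbrev C2 : Type := Fin 2 → ℂ

/-! ### Polynomial diffeomorphisms and the dynamical degree -/

/-- The coordinate polynomials `p` represent the map `F`. -/
def Represents (p : Fin 2 → MvPolynomial (Fin 2) ℂ) (F : C2 → C2) : Prop :=
  ∀ x i, F x i = MvPolynomial.eval x (p i)

/-- A bijection of `ℂ²` given by polynomials whose inverse is smooth (the map itself, being
polynomial, is smooth as well). -/
def IsPolynomialDiffeo (f : C2 ≃ C2) : Prop :=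
  (∃ p, Represents p f) ∧ ContDiff ℝ ∞ f.symm

/-- The degree of a polynomial map: the maximum of the total degrees of its coordinate
polynomials (which are uniquely determined by the map). -/
def polyDegree (F : C2 → C2) : ℕ :=
  sInf {m | ∃ p, Represents p F ∧ ∀ i, (p i).totalDegree ≤ m}

/-- `d` is the dynamical degree `lim (deg fⁿ)^(1/n)` of `f`. -/
def HasDynamicalDegree (f : C2 → C2) (d : ℝ) : Prop :=
  Filter.Tendsto (fun n : ℕ => (polyDegree f^[n] : ℝ) ^ (1 / (n : ℝ))) Filter.atTop (𝓝 d)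

/-! ### Julia sets -/

/-- `K⁺`: the points with bounded forward orbit. -/
def Kplus (f : C2 ≃ C2) : Set C2 :=
  {x | Bornology.IsBounded (Set.range fun n : ℕ => f^[n] x)}

/-- `K⁻`: the points with bounded backward orbit. -/
def Kminus (f : C2 ≃ C2) : Set C2 := Kplus f.symm

/-- The Julia set `J = ∂K⁺ ∩ ∂K⁻`. -/
def juliaSet (f : C2 ≃ C2) : Set C2 := frontier (Kplus f) ∩ frontier (Kminus f)

/-! ### Hyperbolic sets -/

/-- `Λ` is a hyperbolic set of the diffeomorphism `f`: it is compact and invariant, and over it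
there are a continuous invariant splitting `Es ⊕ Eu` of the tangent bundle and a continuous norm
`‖·‖_x` for which `Df` uniformly expands `Eu` and `Df⁻¹` uniformly expands `Es`.
Continuity of the splitting is continuity in `x` of the projection `P x` onto `Eu x` with
kernel `Es x`. Values of `Es`, `Eu`, `P`, `nrm` off `Λ` play no role. -/
def IsHyperbolicOn (f : C2 ≃ C2) (Λ : Set C2) : Prop :=
  IsCompact Λ ∧ f '' Λ = Λ ∧
  ∃ (Es Eu : C2 → Submodule ℂ C2) (P : C2 → C2 →L[ℂ] C2) (nrm : C2 → Seminorm ℂ C2) (lam : ℝ),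
    (∀ x ∈ Λ, IsCompl (Es x) (Eu x)) ∧
    (∀ x ∈ Λ, (∀ v ∈ Eu x, P x v = v) ∧ ∀ v ∈ Es x, P x v = 0) ∧
    ContinuousOn P Λ ∧
    (∀ x ∈ Λ, (Es x).map (fderiv ℂ f x : C2 →ₗ[ℂ] C2) = Es (f x)) ∧
    (∀ x ∈ Λ, (Eu x).map (fderiv ℂ f x : C2 →ₗ[ℂ] C2) = Eu (f x)) ∧
    (∀ x ∈ Λ, ∀ v, nrm x v = 0 → v = 0) ∧
    ContinuousOn (fun q : C2 × C2 => nrm q.1 q.2) (Λ ×ˢ Set.univ) ∧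
    1 < lam ∧
    (∀ x ∈ Λ, ∀ w ∈ Eu x, lam * nrm x w ≤ nrm (f x) (fderiv ℂ f x w)) ∧
    (∀ x ∈ Λ, ∀ w ∈ Es x, lam * nrm x w ≤ nrm (f.symm x) (fderiv ℂ f.symm x w))

/-! ### Boxes and box chain models -/

/-- The `L^∞` norm of `ℝ⁴ = ℂ²`. -/
def boxNorm (x : C2) : ℝ :=
  max (max |(x 0).re| |(x 0).im|) (max |(x 1).re| |(x 1).im|)

/-- The closed box with centre `c` and radius `r`. -/
def box (c : C2) (r : ℝ) : Set C2 := {x | boxNorm (x - c) ≤ r}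

/-- The `δ`-neighbourhood of a set in the `L^∞` metric. -/
def nbhd (B : Set C2) (δ : ℝ) : Set C2 := {x | ∃ y ∈ B, boxNorm (x - y) < δ}

/-- A box chain model of `f` on `J`: a strongly connected directed graph on finitely many closed
boxes with disjoint interiors that cover `J`, having (at least) all edges `k ⟶ j` for which
`f (B k)` meets the `δ`-neighbourhood of `B j`, for some `δ > 0`. -/
structure BoxChainModel (f : C2 ≃ C2) (J : Set C2) where
  /-- the number of boxes -/
  N : ℕ
  /-- the centres of the boxes -/
  center : Fin N → C2
  /-- the radii of the boxes -/
  radius : Fin N → ℝ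
  radius_pos : ∀ k, 0 < radius k
  disjoint_interiors : ∀ k j, k ≠ j →
    Disjoint (interior (box (center k) (radius k))) (interior (box (center j) (radius j)))
  covers : J ⊆ ⋃ k, box (center k) (radius k)
  /-- the directed graph on the (indices of the) boxes -/
  graph : Digraph (Fin N)
  has_edges : ∃ δ > 0, ∀ k j,
    (f '' box (center k) (radius k) ∩ nbhd (box (center j) (radius j)) δ).Nonempty →
      graph.Adj k j
  strongly_connected : ∀ k j, Relation.ReflTransGen graph.Adj k j

/-- The `k`-th box of the model. -/
def BoxChainModel.B {f : C2 ≃ C2} {J : Set C2} (Γ : BoxChainModel f J) (k : Fin Γ.N) : Set C2 :=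
  box (Γ.center k) (Γ.radius k)

/-! ### Box hyperbolicity -/

/-- The form `w ↦ w* A w`, which is real valued for Hermitian `A`. -/
def form (A : Matrix (Fin 2) (Fin 2) ℂ) (w : C2) : ℝ := (star w ⬝ᵥ A *ᵥ w).re

/-- `A` defines a nondegenerate indefinite Hermitian form. -/
def IsIndefiniteHermitian (A : Matrix (Fin 2) (Fin 2) ℂ) : Prop :=
  A.IsHermitian ∧ A.det ≠ 0 ∧ (∃ w, 0 < form A w) ∧ ∃ v, form A v < 0

/-- The unstable cone of a form. -/
def unstableCone (A : Matrix (Fin 2) (Fin 2) ℂ) : Set C2 := {w | 0 ≤ form A w}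

/-- The stable cone of a form, the complement of the unstable cone. -/
def stableCone (A : Matrix (Fin 2) (Fin 2) ℂ) : Set C2 := (unstableCone A)ᶜ

/-- Box hyperbolicity: for some choice of nondegenerate indefinite Hermitian forms `Q k`, one for
each box, `Df` preserves and expands the unstable cones and `(Df)⁻¹` preserves and expands the
stable cones along all edges. (The zero vector lies in every unstable cone and cannot be
strictly expanded.) -/
def BoxChainModel.IsBoxHyperbolic {f : C2 ≃ C2} {J : Set C2} (Γ : BoxChainModel f J) : Prop :=
  ∃ Q : Fin Γ.N → Matrix (Fin 2) (Fin 2) ℂ,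
    (∀ k, IsIndefiniteHermitian (Q k)) ∧
    ∀ k j, Γ.graph.Adj k j → ∀ z ∈ Γ.B k,
      (∀ w ∈ unstableCone (Q k), w ≠ 0 →
        fderiv ℂ f z w ∈ unstableCone (Q j) ∧
        form (Q k) w < form (Q j) (fderiv ℂ f z w)) ∧
      (∀ v ∈ stableCone (Q j),
        (fderiv ℂ f z).inverse v ∈ stableCone (Q k) ∧
        -form (Q j) v < -form (Q k) ((fderiv ℂ f z).inverse v))

end BoxHyp

end

/-! Along an edge (k, j) the two cone conditions together say that Q_j(Df w) > Q_k(w) for every w ≠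
0 (`form_lt_form_apply`). Boxes are compact and edges finite in number, so the gain is at least
c‖w‖² with one c > 0. Give each x in J the form q_x of some box containing x. Since x and f(x) then
lie in boxes joined by an edge, q is a Lyapunov function for Df over J (`exists_isLyapunov`),
although it need not be continuous in x.

Let E^s consist of the vectors with bounded forward orbit, and E^u of those with bounded orbit under
Df⁻¹, for which -q is a Lyapunov function (`isLyapunov_symm`). On E^s the form must stay
nonpositive, and this forces exponential decay at a rate depending only on c and M. The decay
estimates characterize E^s without mentioning q (`mem_stable_iff`), so E^s is closed in (x, w)
whatever the choice of q. Both spaces are nonzero by compactness (`exists_ne_zero_mem_stable`) and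
meet only in 0 because q has opposite signs on them; in dimension two they split the tangent space.
Closedness and compactness of J bound the angle between them from below, which makes the splitting
continuous. Finally, a weighted sum of the norms of finitely many iterates turns eventual
contraction into contraction in one step. -/

noncomputable section

/-! ### Linear cocycles and their spaces of bounded orbits -/

namespace LinearCocycle

open Set Filter

variable {X E : Type*} [NormedAddCommGroup E] [NormedSpace ℂ E]

/-- The iterates of the linear cocycle generated by `A` over the map `T`. -/
def iter (T : X → X) (A : X → E →L[ℂ] E) : ℕ → X → E →L[ℂ] E
  | 0, _ => ContinuousLinearMap.id ℂ E
  | n + 1, x => (iter T A n (T x)).comp (A x)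

variable {T : X → X} {A : X → E →L[ℂ] E}

@[simp] lemma iter_zero_apply (x : X) (w : E) : iter T A 0 x w = w := rfl

lemma iter_succ_apply (n : ℕ) (x : X) (w : E) :
    iter T A (n + 1) x w = iter T A n (T x) (A x w) := rfl

lemma iter_succ_apply' (n : ℕ) (x : X) (w : E) :
    iter T A (n + 1) x w = A (T^[n] x) (iter T A n x w) := by
  induction n generalizing x w with
  | zero => rfl
  | succ n ih => rw [iter_succ_apply, ih, iter_succ_apply, Function.iterate_succ_apply]

lemma continuous_iter [TopologicalSpace X] (hT : Continuous T) (hA : Continuous A) (n : ℕ) :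
    Continuous (iter T A n) := by
  induction n with
  | zero => exact continuous_const
  | succ n ih => exact (ih.comp hT).clm_comp hA

/-- The vectors whose orbit under the cocycle is bounded. -/
def stable (T : X → X) (A : X → E →L[ℂ] E) (x : X) : Submodule ℂ E where
  carrier := {w | ∃ C, ∀ n, ‖iter T A n x w‖ ≤ C}
  zero_mem' := ⟨0, fun n => by simp⟩
  add_mem' := by
    rintro v w ⟨C, hC⟩ ⟨D, hD⟩
    refine ⟨C + D, fun n => ?_⟩
    rw [map_add]
    exact (norm_add_le _ _).trans (add_le_add (hC n) (hD n))
  smul_mem' := by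
    rintro t w ⟨C, hC⟩
    refine ⟨‖t‖ * C, fun n => ?_⟩
    rw [map_smul, norm_smul]
    exact mul_le_mul_of_nonneg_left (hC n) (norm_nonneg t)

lemma apply_mem_stable_iff {x : X} {w : E} : A x w ∈ stable T A (T x) ↔ w ∈ stable T A x := by
  constructor
  · rintro ⟨C, hC⟩
    refine ⟨max C ‖w‖, fun n => ?_⟩
    cases n with
    | zero => exact le_max_right _ _
    | succ n => exact (hC n).trans (le_max_left _ _)
  · rintro ⟨C, hC⟩
    exact ⟨C, fun n => hC (n + 1)⟩

lemma iter_mem_stable {x : X} {w : E} (hw : w ∈ stable T A x) (n : ℕ) :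
    iter T A n x w ∈ stable T A (T^[n] x) := by
  induction n with
  | zero => exact hw
  | succ n ih =>
    rw [iter_succ_apply', Function.iterate_succ_apply']
    exact apply_mem_stable_iff.2 ih

/-- A quadratically bounded function that increases uniformly along the orbits of a cocycle. -/
structure IsLyapunov (T : X → X) (A : X → E →L[ℂ] E) (J : Set X) (q : X → E → ℝ) (c M : ℝ) :
    Prop where
  pos : 0 < c
  lt : c < M
  mapsTo : MapsTo T J J
  bound : ∀ x ∈ J, ∀ w, |q x w| ≤ M * ‖w‖ ^ 2
  increase : ∀ x ∈ J, ∀ w, q x w + c * ‖w‖ ^ 2 ≤ q (T x) (A x w)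

/-! ### Growth, decay and closedness from a Lyapunov function -/

namespace IsLyapunov

variable {J : Set X} {q : X → E → ℝ} {c M : ℝ}

lemma mono (h : IsLyapunov T A J q c M) {c' : ℝ} (hc' : 0 < c') (hle : c' ≤ c) :
    IsLyapunov T A J q c' M where
  pos := hc'
  lt := hle.trans_lt h.lt
  mapsTo := h.mapsTo
  bound := h.bound
  increase := fun x hx w => by
    have h1 := h.increase x hx w
    have h2 := mul_le_mul_of_nonneg_right hle (sq_nonneg ‖w‖)
    linarith

lemma iterate_mem (h : IsLyapunov T A J q c M) {x : X} (hx : x ∈ J) (n : ℕ) : T^[n] x ∈ J :=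
  h.mapsTo.iterate n hx

lemma increase_iter (h : IsLyapunov T A J q c M) {x : X} (hx : x ∈ J) (w : E) (n : ℕ) :
    q (T^[n] x) (iter T A n x w) + c * ‖iter T A n x w‖ ^ 2 ≤
      q (T^[n + 1] x) (iter T A (n + 1) x w) := by
  rw [iter_succ_apply', Function.iterate_succ_apply']
  exact h.increase _ (h.iterate_mem hx n) _

/-- Turns the additive gain c‖w‖² into a relative one: each step raises q by at least the fraction c
/ M of |q|. -/
lemma ratio_mul_le (h : IsLyapunov T A J q c M) {x : X} (hx : x ∈ J) (w : E) :
    c / M * |q x w| ≤ c * ‖w‖ ^ 2 := by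
  have hM : 0 < M := h.pos.trans h.lt
  calc c / M * |q x w| ≤ c / M * (M * ‖w‖ ^ 2) :=
        mul_le_mul_of_nonneg_left (h.bound x hx w) (div_pos h.pos hM).le
    _ = c * ‖w‖ ^ 2 := by field_simp

/-- A positive value of q would grow by the factor 1 + c / M at each step, while a bounded orbit
keeps q below M C². -/
lemma nonpos_of_mem_stable (h : IsLyapunov T A J q c M) {x : X} (hx : x ∈ J) {w : E}
    (hw : w ∈ stable T A x) : q x w ≤ 0 := by
  by_contra! hpos
  have hM : 0 < M := h.pos.trans h.lt
  have hr : 0 < c / M := div_pos h.pos hM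
  have grow : ∀ n, (1 + c / M) ^ n * q x w ≤ q (T^[n] x) (iter T A n x w) := by
    intro n
    induction n with
    | zero => simp
    | succ n ih =>
      have h1 := h.increase_iter hx w n
      have h2 := h.ratio_mul_le (h.iterate_mem hx n) (iter T A n x w)
      have h3 := mul_le_mul_of_nonneg_left (le_abs_self (q (T^[n] x) (iter T A n x w))) hr.le
      have h4 := mul_le_mul_of_nonneg_left ih (by positivity : 0 ≤ 1 + c / M)
      rw [pow_succ']
      linarith
  obtain ⟨C, hC⟩ := hw
  obtain ⟨n, hn⟩ := pow_unbounded_of_one_lt (M * C ^ 2 / q x w) (by linarith : 1 < 1 + c / M)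
  rw [div_lt_iff₀ hpos] at hn
  have h1 := (le_abs_self _).trans (h.bound _ (h.iterate_mem hx n) (iter T A n x w))
  have h2 : M * ‖iter T A n x w‖ ^ 2 ≤ M * C ^ 2 := by
    gcongr
    exact hC n
  linarith [grow n]

/-- While q stays nonpositive, -q shrinks by the factor 1 - c / M per step. It also dominates c‖·‖²
at time n, because q is still nonpositive at time n + 1. -/
lemma decay (h : IsLyapunov T A J q c M) {x : X} (hx : x ∈ J) {w : E}
    (hw : ∀ n, q (T^[n] x) (iter T A n x w) ≤ 0) (n : ℕ) :
    c * ‖iter T A n x w‖ ^ 2 ≤ M * (1 - c / M) ^ n * ‖w‖ ^ 2 := by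
  have hM : 0 < M := h.pos.trans h.lt
  have hr : 0 ≤ 1 - c / M := by
    rw [sub_nonneg, div_le_one hM]
    exact h.lt.le
  have dec : ∀ n, -q (T^[n] x) (iter T A n x w) ≤ (1 - c / M) ^ n * -q x w := by
    intro n
    induction n with
    | zero => simp
    | succ n ih =>
      have h1 := h.increase_iter hx w n
      have h2 := h.ratio_mul_le (h.iterate_mem hx n) (iter T A n x w)
      rw [abs_of_nonpos (hw n)] at h2
      have h4 := mul_le_mul_of_nonneg_left ih hr
      rw [pow_succ']
      linarith
  have h1 := h.increase_iter hx w n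
  have h2 := (neg_le_abs _).trans (h.bound x hx w)
  have h3 := mul_le_mul_of_nonneg_left h2 (pow_nonneg hr n)
  linarith [hw (n + 1), dec n]

/-- The right-hand side involves only the cocycle and the constants, so for continuous `T` and `A`
it is a closed condition on (x, w) even if q jumps with x. -/
lemma mem_stable_iff (h : IsLyapunov T A J q c M) {x : X} (hx : x ∈ J) {w : E} :
    w ∈ stable T A x ↔
      ∀ n, c * ‖iter T A n x w‖ ^ 2 ≤ M * (1 - c / M) ^ n * ‖w‖ ^ 2 := by
  have hM : 0 < M := h.pos.trans h.lt
  refine ⟨fun hw => h.decay hx fun n =>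
    h.nonpos_of_mem_stable (h.iterate_mem hx n) (iter_mem_stable hw n), fun hw => ?_⟩
  -- The squared norms are at most M / c * ‖w‖²; adding 1 bounds the norms themselves, since 2t ≤ t²
  -- + 1.
  refine ⟨M / c * ‖w‖ ^ 2 + 1, fun n => ?_⟩
  have hr : 0 ≤ 1 - c / M := by
    rw [sub_nonneg, div_le_one hM]
    exact h.lt.le
  have hr1 : (1 - c / M) ^ n ≤ 1 := pow_le_one₀ hr (by linarith [div_pos h.pos hM])
  have h1 : c * ‖iter T A n x w‖ ^ 2 ≤ M * ‖w‖ ^ 2 := (hw n).trans <| by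
    have := mul_le_mul_of_nonneg_left hr1 (by positivity : 0 ≤ M * ‖w‖ ^ 2)
    linarith
  have h2 : ‖iter T A n x w‖ ^ 2 ≤ M / c * ‖w‖ ^ 2 := by
    rw [div_mul_eq_mul_div, le_div_iff₀ h.pos]
    linarith
  nlinarith [sq_nonneg (‖iter T A n x w‖ - 1)]

lemma mem_stable_of_nonpos (h : IsLyapunov T A J q c M) {x : X} (hx : x ∈ J) {w : E}
    (hw : ∀ n, q (T^[n] x) (iter T A n x w) ≤ 0) : w ∈ stable T A x :=
  (h.mem_stable_iff hx).2 (h.decay hx hw)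

lemma norm_sq_le_neg (h : IsLyapunov T A J q c M) {x : X} (hx : x ∈ J) {w : E}
    (hw : w ∈ stable T A x) : c * ‖w‖ ^ 2 ≤ -q x w := by
  have h1 := h.increase x hx w
  have h2 := h.nonpos_of_mem_stable (h.mapsTo hx) (apply_mem_stable_iff.2 hw)
  linarith

/-- The unit vectors with q ≤ 0 at time n form nonempty compact sets, decreasing in n because q
increases along orbits. A common point has q ≤ 0 at all times. -/
lemma exists_ne_zero_mem_stable [FiniteDimensional ℂ E] (h : IsLyapunov T A J q c M)
    (hcont : ∀ x, Continuous (q x)) (hsmul : ∀ x (t : ℂ) w, q x (t • w) = ‖t‖ ^ 2 * q x w)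
    (hneg : ∀ x ∈ J, ∃ v, q x v < 0) (hsurj : ∀ x, Function.Surjective (A x)) {x : X} (hx : x ∈ J) :
    ∃ w ∈ stable T A x, w ≠ 0 := by
  have hsurj' : ∀ n x, Function.Surjective (iter T A n x) := by
    intro n
    induction n with
    | zero => exact fun x v => ⟨v, rfl⟩
    | succ n ih => exact fun x => (ih (T x)).comp (hsurj x)
  let S : ℕ → Set E := fun n =>
    Metric.sphere 0 1 ∩ {w | q (T^[n] x) (iter T A n x w) ≤ 0}
  have hclosed : ∀ n, IsClosed (S n) := fun n => Metric.isClosed_sphere.inter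
    (isClosed_le ((hcont _).comp (iter T A n x).continuous) continuous_const)
  have hne : (⋂ n, S n).Nonempty := by
    refine IsCompact.nonempty_iInter_of_sequence_nonempty_isCompact_isClosed S ?_ ?_ ?_ hclosed
    · rintro n w ⟨hw, hw'⟩
      refine ⟨hw, ?_⟩
      have h1 := h.increase_iter hx w n
      have h2 := mul_nonneg h.pos.le (sq_nonneg ‖iter T A n x w‖)
      simp only [mem_ofPred_eq] at hw' ⊢
      linarith
    -- Pull a negative vector at time n back by the surjective iterate and normalize it.
    · intro n
      obtain ⟨v, hv⟩ := hneg _ (h.iterate_mem hx n)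
      obtain ⟨w, rfl⟩ := hsurj' n x v
      have hw : w ≠ 0 := by
        rintro rfl
        have h0 := h.bound _ (h.iterate_mem hx n) (iter T A n x 0)
        have h1 : |q (T^[n] x) (iter T A n x 0)| ≤ 0 := by simpa using h0
        exact hv.ne (abs_nonpos_iff.1 h1)
      refine ⟨((‖w‖⁻¹ : ℝ) : ℂ) • w, ?_, ?_⟩
      · simp [norm_smul, hw]
      · simp only [mem_ofPred_eq, map_smul, hsmul]
        exact mul_nonpos_of_nonneg_of_nonpos (sq_nonneg _) hv.le
    · exact (isCompact_sphere 0 1).inter_right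
        (isClosed_le ((hcont _).comp (iter T A 0 x).continuous) continuous_const)
  obtain ⟨w, hw⟩ := hne
  rw [mem_iInter] at hw
  refine ⟨w, h.mem_stable_of_nonpos hx fun n => (hw n).2, ?_⟩
  rintro rfl
  simpa using (hw 0).1

lemma mem_stable_of_tendsto [TopologicalSpace X] (h : IsLyapunov T A J q c M) (hT : Continuous T)
    (hA : Continuous A) {ι : Type*} {l : Filter ι} [l.NeBot] {a : ι → X} {b : ι → E} {x : X}
    {w : E} (hx : x ∈ J) (ha : Tendsto a l (𝓝 x)) (hb : Tendsto b l (𝓝 w))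
    (hab : ∀ᶠ i in l, a i ∈ J ∧ b i ∈ stable T A (a i)) : w ∈ stable T A x := by
  refine (h.mem_stable_iff hx).2 fun n => ?_
  have h1 : Tendsto (fun i => iter T A n (a i) (b i)) l (𝓝 (iter T A n x w)) :=
    ((isBoundedBilinearMap_apply (𝕜 := ℂ) (E := E) (F := E)).continuous.tendsto
      (iter T A n x, w)).comp ((((continuous_iter hT hA n).tendsto x).comp ha).prodMk_nhds hb)
  refine le_of_tendsto_of_tendsto ((h1.norm.pow 2).const_mul c) ((hb.norm.pow 2).const_mul _) ?_
  filter_upwards [hab] with i hi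
  exact (h.mem_stable_iff hi.1).1 hi.2 n

/-- The vectors of the stable spaces are contracted at a uniform exponential rate. -/
lemma norm_iter_le (h : IsLyapunov T A J q c M) {lam : ℝ} (hlam : 0 < lam) {N : ℕ}
    (hN : (lam ^ 2 * (1 - c / M)) ^ N * M ≤ c) {x : X} (hx : x ∈ J) {w : E}
    (hw : w ∈ stable T A x) : lam ^ N * ‖iter T A N x w‖ ≤ ‖w‖ := by
  have h1 := (h.mem_stable_iff hx).1 hw N
  have h2 := mul_le_mul_of_nonneg_left h1 (by positivity : 0 ≤ (lam ^ 2) ^ N)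
  have h3 := mul_le_mul_of_nonneg_right hN (sq_nonneg ‖w‖)
  rw [mul_pow] at h3
  have h4 : c * (lam ^ N * ‖iter T A N x w‖) ^ 2 ≤ c * ‖w‖ ^ 2 := by
    calc c * (lam ^ N * ‖iter T A N x w‖) ^ 2
        = (lam ^ 2) ^ N * (c * ‖iter T A N x w‖ ^ 2) := by ring
      _ ≤ _ := by linarith
  exact le_of_sq_le_sq (le_of_mul_le_mul_left h4 h.pos) (norm_nonneg w)

end IsLyapunov

/-- The weighted sum of the norms of the first `N` iterates. -/
def adaptedNorm (T : X → X) (A : X → E →L[ℂ] E) (lam : ℝ) (N : ℕ) (x : X) (w : E) : ℝ :=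
  ∑ n ∈ Finset.range N, lam ^ n * ‖iter T A n x w‖

/-- The sum telescopes: one step of the cocycle, weighted by `lam`, trades the term n = 0 for the
term n = N, which the hypothesis makes no larger. -/
lemma mul_adaptedNorm_le {lam : ℝ} {N : ℕ} {x : X} {w : E}
    (hN : lam ^ N * ‖iter T A N x w‖ ≤ ‖w‖) :
    lam * adaptedNorm T A lam N (T x) (A x w) ≤ adaptedNorm T A lam N x w := by
  have h1 := Finset.sum_range_succ (fun n => lam ^ n * ‖iter T A n x w‖) N
  rw [Finset.sum_range_succ'] at h1
  have h2 : lam * adaptedNorm T A lam N (T x) (A x w) =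
      ∑ n ∈ Finset.range N, lam ^ (n + 1) * ‖iter T A (n + 1) x w‖ := by
    rw [adaptedNorm, Finset.mul_sum]
    refine Finset.sum_congr rfl fun n _ => ?_
    rw [iter_succ_apply, pow_succ']
    ring
  simp only [pow_zero, one_mul, iter_zero_apply] at h1
  rw [h2, adaptedNorm]
  linarith

end LinearCocycle
end

noncomputable section

/-! ### The continuous splitting into stable and unstable spaces -/

namespace LinearCocycle

open Set Filter

variable {X E : Type*} [NormedAddCommGroup E] [NormedSpace ℂ E]

/-- The projection onto `U` along `S` if these subspaces are complementary, and `0` otherwise. -/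
def projAlong [FiniteDimensional ℂ E] (S U : Submodule ℂ E) : E →L[ℂ] E :=
  open Classical in
  if h : IsCompl U S then LinearMap.toContinuousLinearMap (U.subtype ∘ₗ U.projectionOnto S h)
  else 0

section projAlong

variable [FiniteDimensional ℂ E] {S U : Submodule ℂ E}

lemma projAlong_apply_of_mem (h : IsCompl S U) {v : E} (hv : v ∈ U) : projAlong S U v = v := by
  rw [projAlong, dif_pos h.symm]
  exact congrArg Subtype.val (Submodule.projectionOnto_apply_left h.symm ⟨v, hv⟩)

lemma projAlong_apply_eq_zero (h : IsCompl S U) {v : E} (hv : v ∈ S) : projAlong S U v = 0 := by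
  rw [projAlong, dif_pos h.symm]
  exact congrArg Subtype.val (Submodule.projectionOnto_apply_right h.symm ⟨v, hv⟩)

lemma projAlong_add (h : IsCompl S U) {s u : E} (hs : s ∈ S) (hu : u ∈ U) :
    projAlong S U (s + u) = u := by
  rw [map_add, projAlong_apply_eq_zero h hs, projAlong_apply_of_mem h hu, zero_add]

lemma projAlong_mem (h : IsCompl S U) (v : E) : projAlong S U v ∈ U := by
  rw [projAlong, dif_pos h.symm]
  exact Subtype.property _

lemma sub_projAlong_mem (h : IsCompl S U) (v : E) : v - projAlong S U v ∈ S := by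
  obtain ⟨s, hs, u, hu, rfl⟩ := Submodule.mem_sup.1 (h.sup_eq_top ▸ Submodule.mem_top : v ∈ S ⊔ U)
  rwa [projAlong_add h hs hu, add_sub_cancel_right]

end projAlong

variable {T : X ≃ X} {A B : X → E →L[ℂ] E} {J : Set X} {q : X → E → ℝ} {c M : ℝ}

/-- On the intersection both q and -q are at least c‖w‖². -/
lemma disjoint_stable (h : IsLyapunov T A J q c M)
    (h' : IsLyapunov T.symm B J (fun x w => -q x w) c M) {x : X} (hx : x ∈ J) :
    Disjoint (stable T A x) (stable T.symm B x) := by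
  rw [Submodule.disjoint_def]
  intro w hw hw'
  have h1 := h.norm_sq_le_neg hx hw
  have h2 := h'.norm_sq_le_neg hx hw'
  have h3 : ‖w‖ ^ 2 = 0 := by nlinarith [h.pos, sq_nonneg ‖w‖]
  simpa using h3

/-- A uniform lower bound for the angle between the two spaces; it bounds the projections by 1 / ε
over all of `J`. By homogeneity u may be taken of norm 1, and then s + u has a positive minimum over
a compact set. -/
lemma exists_norm_le_norm_add [TopologicalSpace X] [T2Space X] [FiniteDimensional ℂ E]
    (hT : Continuous T) (hT' : Continuous T.symm) (hA : Continuous A) (hB : Continuous B)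
    (hJ : IsCompact J) (h : IsLyapunov T A J q c M)
    (h' : IsLyapunov T.symm B J (fun x w => -q x w) c M) :
    ∃ ε > 0, ∀ x ∈ J, ∀ s ∈ stable T A x, ∀ u ∈ stable T.symm B x, ε * ‖u‖ ≤ ‖s + u‖ := by
  -- Radius 2 keeps s in a compact set; if ‖s‖ > 2‖u‖, the triangle inequality already gives ‖s + u‖
  -- ≥ ‖u‖.
  let K : Set (X × E × E) := J ×ˢ Metric.closedBall 0 2 ×ˢ Metric.sphere 0 1
  let S : Set (X × E × E) := {p | p.2.1 ∈ stable T A p.1 ∧ p.2.2 ∈ stable T.symm B p.1}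
  have hK : IsCompact K :=
    hJ.prod ((isCompact_closedBall 0 2).prod (isCompact_sphere 0 1))
  have hKS : IsClosed (K ∩ S) := by
    refine isClosed_iff_ultrafilter.2 fun p l hl hmem => ?_
    have hpK : p ∈ K := isClosed_iff_ultrafilter.1 hK.isClosed p l hl
      (mem_of_superset hmem inter_subset_left)
    have t1 : Tendsto (fun p : X × E × E => p.1) l (𝓝 p.1) := (continuous_fst.tendsto p).mono_left hl
    have t2 : Tendsto (fun p : X × E × E => p.2.1) l (𝓝 p.2.1) :=
      (continuous_snd.fst.tendsto p).mono_left hl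
    have t3 : Tendsto (fun p : X × E × E => p.2.2) l (𝓝 p.2.2) :=
      (continuous_snd.snd.tendsto p).mono_left hl
    refine ⟨hpK, h.mem_stable_of_tendsto hT hA hpK.1 t1 t2 ?_,
      h'.mem_stable_of_tendsto hT' hB hpK.1 t1 t3 ?_⟩
    · filter_upwards [hmem] with i hi using ⟨hi.1.1, hi.2.1⟩
    · filter_upwards [hmem] with i hi using ⟨hi.1.1, hi.2.2⟩
  have hcompact : IsCompact (K ∩ S) := hK.of_isClosed_subset hKS inter_subset_left
  obtain ⟨ε, hε, hle⟩ := hcompact.exists_forall_le' (a := 0)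
    (f := fun p => ‖p.2.1 + p.2.2‖) (by fun_prop) (by
      rintro ⟨x, s, u⟩ ⟨⟨hx, -, hu1⟩, hs, hu⟩
      refine norm_pos_iff.2 fun h0 => ?_
      have hsu : u = -s := by rw [eq_neg_iff_add_eq_zero, add_comm]; exact h0
      have hu0 : u = 0 := (Submodule.disjoint_def.1 (disjoint_stable h h' hx)) u
        (hsu ▸ neg_mem hs) hu
      simp [hu0] at hu1)
  refine ⟨min ε 1, by positivity, fun x hx s hs u hu => ?_⟩
  rcases eq_or_ne u 0 with rfl | hu0
  · simp
  have hu1 : 0 < ‖u‖ := norm_pos_iff.2 hu0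
  rcases le_or_gt ‖s‖ (2 * ‖u‖) with hsu | hsu
  · let t : ℂ := ((‖u‖⁻¹ : ℝ) : ℂ)
    have ht : ‖t‖ = ‖u‖⁻¹ := by simp [t]
    have h1 := hle (x, t • s, t • u) ⟨⟨hx, by
        rw [mem_closedBall_zero_iff, norm_smul, ht, inv_mul_le_iff₀ hu1]; linarith, by
        rw [mem_sphere_zero_iff_norm, norm_smul, ht, inv_mul_cancel₀ hu1.ne']⟩,
      Submodule.smul_mem _ _ hs, Submodule.smul_mem _ _ hu⟩
    simp only [← smul_add, norm_smul, ht] at h1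
    rw [inv_mul_eq_div, le_div_iff₀ hu1] at h1
    exact (mul_le_mul_of_nonneg_right (min_le_left ε 1) hu1.le).trans h1
  · have h1 := norm_sub_le (s + u) u
    rw [add_sub_cancel_right] at h1
    have h2 := mul_le_mul_of_nonneg_right (min_le_right ε 1) hu1.le
    linarith

/-- Two disjoint nonzero subspaces of a plane are complementary. -/
lemma isCompl_stable (h : IsLyapunov T A J q c M)
    (h' : IsLyapunov T.symm B J (fun x w => -q x w) c M) (hdim : Module.finrank ℂ E = 2)
    (hAB : ∀ x w, A x (B (T x) w) = w) (hBA : ∀ x w, B (T x) (A x w) = w)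
    (hcont : ∀ x, Continuous (q x)) (hsmul : ∀ x (t : ℂ) w, q x (t • w) = ‖t‖ ^ 2 * q x w)
    (hneg : ∀ x ∈ J, ∃ v, q x v < 0) (hpos : ∀ x ∈ J, ∃ v, 0 < q x v) {x : X} (hx : x ∈ J) :
    IsCompl (stable T A x) (stable T.symm B x) := by
  have : FiniteDimensional ℂ E := Module.finite_of_finrank_eq_succ hdim
  have hdisj := disjoint_stable h h' hx
  refine ⟨hdisj, codisjoint_iff.2 (Submodule.eq_top_of_disjoint _ _ ?_ hdisj)⟩
  have h1 : stable T A x ≠ ⊥ := by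
    obtain ⟨w, hw, hw0⟩ := h.exists_ne_zero_mem_stable hcont hsmul hneg
      (fun x v => ⟨B (T x) v, hAB x v⟩) hx
    exact (Submodule.ne_bot_iff _).2 ⟨w, hw, hw0⟩
  have h2 : stable T.symm B x ≠ ⊥ := by
    obtain ⟨w, hw, hw0⟩ := h'.exists_ne_zero_mem_stable (fun x => (hcont x).neg)
      (fun x t w => by rw [hsmul, mul_neg]) (fun x hx => (hpos x hx).imp fun v hv => neg_neg_of_pos hv)
      (fun x v => ⟨A (T.symm x) v, by simpa using hBA (T.symm x) v⟩) hx
    exact (Submodule.ne_bot_iff _).2 ⟨w, hw, hw0⟩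
  have h3 := Submodule.one_le_finrank_iff.2 h1
  have h4 := Submodule.one_le_finrank_iff.2 h2
  omega

/-- For fixed v the projections stay in a compact ball by the angle bound. By closedness, any
cluster point u at x has u in the unstable and v - u in the stable space, hence is the projection of
v at x. -/
lemma continuousOn_projAlong_stable [TopologicalSpace X] [T2Space X] [FiniteDimensional ℂ E]
    (hT : Continuous T) (hT' : Continuous T.symm) (hA : Continuous A) (hB : Continuous B)
    (hJ : IsCompact J) (h : IsLyapunov T A J q c M)
    (h' : IsLyapunov T.symm B J (fun x w => -q x w) c M)
    (hcompl : ∀ x ∈ J, IsCompl (stable T A x) (stable T.symm B x)) :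
    ContinuousOn (fun x => projAlong (stable T A x) (stable T.symm B x)) J := by
  obtain ⟨ε, hε, hle⟩ := exists_norm_le_norm_add hT hT' hA hB hJ h h'
  refine continuousOn_clm_apply.2 fun v x hx => ?_
  refine (isCompact_closedBall (0 : E) (‖v‖ / ε)).tendsto_nhds_of_unique_mapClusterPt ?_ ?_
  · filter_upwards [self_mem_nhdsWithin] with y hy
    have h1 := hle y hy _ (sub_projAlong_mem (hcompl y hy) v) _ (projAlong_mem (hcompl y hy) v)
    rw [sub_add_cancel] at h1
    rw [mem_closedBall_zero_iff, le_div_iff₀ hε]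
    linarith
  · intro u _ hu
    obtain ⟨l, hl, hlu⟩ := mapClusterPt_iff_ultrafilter.1 hu
    have hx' : Tendsto (fun y : X => y) l (𝓝 x) := hl.trans nhdsWithin_le_nhds
    have hJl : ∀ᶠ y in l, y ∈ J := hl self_mem_nhdsWithin
    have h1 : u ∈ stable T.symm B x := by
      refine h'.mem_stable_of_tendsto hT' hB hx hx' hlu ?_
      filter_upwards [hJl] with y hy using ⟨hy, projAlong_mem (hcompl y hy) v⟩
    have h2 : v - u ∈ stable T A x := by
      refine h.mem_stable_of_tendsto hT hA hx hx' (tendsto_const_nhds.sub hlu) ?_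
      filter_upwards [hJl] with y hy using ⟨hy, sub_projAlong_mem (hcompl y hy) v⟩
    have h3 := projAlong_add (hcompl x hx) h2 h1
    rw [sub_add_cancel] at h3
    exact h3.symm

/-! ### The adapted norm and hyperbolicity of the cocycle -/

/-- The norm adapted to the splitting into the stable spaces of a cocycle and of its inverse. -/
def splitNorm (T : X ≃ X) (A B : X → E →L[ℂ] E) (P : X → E →L[ℂ] E) (lam : ℝ) (N : ℕ) (x : X) :
    Seminorm ℂ E :=
  ∑ n ∈ Finset.range N, (‖lam‖₊ ^ n) •
    ((normSeminorm ℂ E).comp (iter T A n x ∘L (ContinuousLinearMap.id ℂ E - P x)).toLinearMap +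
      (normSeminorm ℂ E).comp (iter T.symm B n x ∘L P x).toLinearMap)

lemma splitNorm_apply {P : X → E →L[ℂ] E} {lam : ℝ} (hlam : 0 ≤ lam) {N : ℕ} (x : X) (v : E) :
    splitNorm T A B P lam N x v =
      adaptedNorm T A lam N x (v - P x v) + adaptedNorm T.symm B lam N x (P x v) := by
  have hsum : ∀ (s : Finset ℕ) (g : ℕ → Seminorm ℂ E), (∑ n ∈ s, g n) v = ∑ n ∈ s, g n v :=
    fun s g => by
      induction s using Finset.cons_induction with
      | empty => simp
      | cons a s ha ih => rw [Finset.sum_cons, Finset.sum_cons, add_apply, ih]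
  rw [splitNorm, hsum, adaptedNorm, adaptedNorm, ← Finset.sum_add_distrib]
  refine Finset.sum_congr rfl fun n _ => ?_
  simp [NNReal.smul_def, abs_of_nonneg hlam]

lemma adaptedNorm_zero {T : X → X} (lam : ℝ) (N : ℕ) (x : X) :
    adaptedNorm T A lam N x 0 = 0 := by
  simp [adaptedNorm]

lemma norm_le_adaptedNorm {T : X → X} {lam : ℝ} (hlam : 0 ≤ lam) {N : ℕ} (hN : 0 < N) (x : X)
    (w : E) : ‖w‖ ≤ adaptedNorm T A lam N x w := by
  have := Finset.single_le_sum (f := fun n => lam ^ n * ‖iter T A n x w‖)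
    (fun n _ => by positivity) (Finset.mem_range.2 hN)
  simpa [adaptedNorm] using this

lemma continuousOn_adaptedNorm [TopologicalSpace X] {T : X → X} (hT : Continuous T)
    (hA : Continuous A) (lam : ℝ) (N : ℕ) {Y : Type*} [TopologicalSpace Y] {s : Set Y} {a : Y → X}
    {b : Y → E} (ha : ContinuousOn a s) (hb : ContinuousOn b s) :
    ContinuousOn (fun y => adaptedNorm T A lam N (a y) (b y)) s := by
  refine continuousOn_finsetSum _ fun n _ => continuousOn_const.mul (ContinuousOn.norm ?_)
  exact ((continuous_iter hT hA n).comp_continuousOn ha).clm_apply hb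

/-- Any `lam` with 1 < `lam`² < (1 - c / M)⁻¹ works, as the powers then tend to 0. -/
lemma exists_rate (hc : 0 < c) (hM : c < M) :
    ∃ lam : ℝ, 1 < lam ∧ ∃ N : ℕ, 0 < N ∧ (lam ^ 2 * (1 - c / M)) ^ N * M ≤ c := by
  have hM0 : 0 < M := hc.trans hM
  have hr0 : 0 < 1 - c / M := by
    rw [sub_pos, div_lt_one hM0]
    exact hM
  have hr1 : 1 - c / M < 1 := by linarith [div_pos hc hM0]
  obtain ⟨b, hb1, hb2⟩ := exists_between ((one_lt_inv₀ hr0).2 hr1)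
  have hb0 : 0 < b := one_pos.trans hb1
  refine ⟨√b, by rwa [Real.lt_sqrt one_pos.le, one_pow], ?_⟩
  rw [Real.sq_sqrt hb0.le]
  have h1 : b * (1 - c / M) < 1 := by
    rwa [lt_inv_comm₀ hb0 hr0, ← one_div, lt_div_iff₀ hb0, mul_comm] at hb2
  obtain ⟨N, hN⟩ := exists_pow_lt_of_lt_one (div_pos hc hM0) h1
  -- A positive number of terms is needed for the adapted norm to dominate ‖·‖ and so be definite.
  refine ⟨N + 1, N.succ_pos, ?_⟩
  have h2 : (b * (1 - c / M)) ^ (N + 1) ≤ (b * (1 - c / M)) ^ N :=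
    pow_le_pow_of_le_one (by positivity) h1.le N.le_succ
  exact (le_div_iff₀ hM0).1 (h2.trans hN.le)

lemma map_stable_eq {T : X → X} {x : X} (hsurj : Function.Surjective (A x)) :
    (stable T A x).map (A x : E →ₗ[ℂ] E) = stable T A (T x) := by
  ext v
  obtain ⟨w, rfl⟩ := hsurj v
  constructor
  · rintro ⟨w', hw', h⟩
    have h' : A x w' = A x w := h
    rw [← h']
    exact apply_mem_stable_iff.2 hw'
  · exact fun h => ⟨w, apply_mem_stable_iff.1 h, rfl⟩

lemma map_stable_symm_eq (hAB : ∀ x w, A x (B (T x) w) = w) (hBA : ∀ x w, B (T x) (A x w) = w)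
    (x : X) : (stable T.symm B x).map (A x : E →ₗ[ℂ] E) = stable T.symm B (T x) := by
  have key : ∀ w, B (T x) w ∈ stable T.symm B x ↔ w ∈ stable T.symm B (T x) := fun w => by
    rw [← apply_mem_stable_iff (x := T x), Equiv.symm_apply_apply]
  ext v
  constructor
  · rintro ⟨w, hw, rfl⟩
    rw [← key]
    simpa [hBA] using hw
  · exact fun h => ⟨B (T x) v, (key v).2 h, hAB x v⟩

/-- A two-dimensional cocycle over a compact set with an indefinite quadratic Lyapunov function is
hyperbolic. -/
theorem exists_hyperbolic_splitting [TopologicalSpace X] [T2Space X]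
    (hT : Continuous T) (hT' : Continuous T.symm) (hA : Continuous A) (hB : Continuous B)
    (hJ : IsCompact J) (h : IsLyapunov T A J q c M)
    (h' : IsLyapunov T.symm B J (fun x w => -q x w) c M) (hdim : Module.finrank ℂ E = 2)
    (hAB : ∀ x w, A x (B (T x) w) = w) (hBA : ∀ x w, B (T x) (A x w) = w)
    (hcont : ∀ x, Continuous (q x)) (hsmul : ∀ x (t : ℂ) w, q x (t • w) = ‖t‖ ^ 2 * q x w)
    (hneg : ∀ x ∈ J, ∃ v, q x v < 0) (hpos : ∀ x ∈ J, ∃ v, 0 < q x v) :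
    ∃ (Es Eu : X → Submodule ℂ E) (P : X → E →L[ℂ] E) (nrm : X → Seminorm ℂ E) (lam : ℝ),
      (∀ x ∈ J, IsCompl (Es x) (Eu x)) ∧
      (∀ x ∈ J, (∀ v ∈ Eu x, P x v = v) ∧ ∀ v ∈ Es x, P x v = 0) ∧
      ContinuousOn P J ∧
      (∀ x ∈ J, (Es x).map (A x : E →ₗ[ℂ] E) = Es (T x)) ∧
      (∀ x ∈ J, (Eu x).map (A x : E →ₗ[ℂ] E) = Eu (T x)) ∧
      (∀ x ∈ J, ∀ v, nrm x v = 0 → v = 0) ∧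
      ContinuousOn (fun p : X × E => nrm p.1 p.2) (J ×ˢ univ) ∧
      1 < lam ∧
      (∀ x ∈ J, ∀ w ∈ Eu x, lam * nrm x w ≤ nrm (T x) (A x w)) ∧
      (∀ x ∈ J, ∀ w ∈ Es x, lam * nrm x w ≤ nrm (T.symm x) (B x w)) := by
  have : FiniteDimensional ℂ E := Module.finite_of_finrank_eq_succ hdim
  obtain ⟨lam, hlam, N, hN0, hN⟩ := exists_rate h.pos h.lt
  have hlam0 : 0 < lam := one_pos.trans hlam
  have hcompl : ∀ x ∈ J, IsCompl (stable T A x) (stable T.symm B x) := fun x hx =>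
    isCompl_stable h h' hdim hAB hBA hcont hsmul hneg hpos hx
  have hPcont := continuousOn_projAlong_stable hT hT' hA hB hJ h h' hcompl
  set P : X → E →L[ℂ] E := fun x => projAlong (stable T A x) (stable T.symm B x) with hP
  have nrm_s : ∀ x ∈ J, ∀ w ∈ stable T A x,
      splitNorm T A B P lam N x w = adaptedNorm T A lam N x w := fun x hx w hw => by
    rw [splitNorm_apply hlam0.le, projAlong_apply_eq_zero (hcompl x hx) hw, adaptedNorm_zero,
      sub_zero, add_zero]
  have nrm_u : ∀ x ∈ J, ∀ w ∈ stable T.symm B x,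
      splitNorm T A B P lam N x w = adaptedNorm T.symm B lam N x w := fun x hx w hw => by
    rw [splitNorm_apply hlam0.le, projAlong_apply_of_mem (hcompl x hx) hw, sub_self,
      adaptedNorm_zero, zero_add]
  refine ⟨stable T A, stable T.symm B, P, splitNorm T A B P lam N, lam, hcompl,
    fun x hx => ⟨fun v hv => projAlong_apply_of_mem (hcompl x hx) hv,
      fun v hv => projAlong_apply_eq_zero (hcompl x hx) hv⟩, hPcont,
    fun x _ => map_stable_eq fun v => ⟨B (T x) v, hAB x v⟩,
    fun x _ => map_stable_symm_eq hAB hBA x, ?_, ?_, hlam, ?_, ?_⟩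
  · intro x _ v hv
    rw [splitNorm_apply hlam0.le] at hv
    have h1 := norm_le_adaptedNorm (T := T) (A := A) hlam0.le hN0 x (v - P x v)
    have h2 := norm_le_adaptedNorm (T := T.symm) (A := B) hlam0.le hN0 x (P x v)
    have h3 : ‖P x v‖ = 0 := by linarith [norm_nonneg (v - P x v), norm_nonneg (P x v)]
    have h4 : ‖v - P x v‖ = 0 := by linarith [norm_nonneg (v - P x v), norm_nonneg (P x v)]
    rw [norm_eq_zero] at h3 h4
    rwa [h3, sub_zero] at h4
  · simp only [splitNorm_apply hlam0.le]
    have h1 : ContinuousOn (fun p : X × E => p.1) (J ×ˢ univ) := continuousOn_fst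
    have h2 : ContinuousOn (fun p : X × E => P p.1 p.2) (J ×ˢ univ) :=
      (hPcont.comp h1 fun p hp => hp.1).clm_apply continuousOn_snd
    exact (continuousOn_adaptedNorm hT hA lam N h1 (continuousOn_snd.sub h2)).add
      (continuousOn_adaptedNorm hT' hB lam N h1 h2)
  · intro x hx w hw
    have hTx := h.mapsTo hx
    have hw' : A x w ∈ stable T.symm B (T x) := by
      rw [← map_stable_symm_eq hAB hBA x]
      exact ⟨w, hw, rfl⟩
    rw [nrm_u x hx w hw, nrm_u _ hTx _ hw']
    -- Contraction of the inverse cocycle at T x, applied to the image of w, is expansion of w.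
    have h1 := mul_adaptedNorm_le (h'.norm_iter_le hlam0 hN hTx hw')
    rwa [hBA, Equiv.symm_apply_apply] at h1
  · intro x hx w hw
    have hTx := h'.mapsTo hx
    have hAB' : A (T.symm x) (B x w) = w := by simpa using hAB (T.symm x) w
    have hw' : B x w ∈ stable T A (T.symm x) := by
      rw [← apply_mem_stable_iff, hAB', Equiv.apply_symm_apply]
      exact hw
    rw [nrm_s x hx w hw, nrm_s _ hTx _ hw']
    have h1 := mul_adaptedNorm_le (h.norm_iter_le hlam0 hN hTx hw')
    rwa [hAB', Equiv.apply_symm_apply] at h1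

end LinearCocycle
end

noncomputable section

/-! ### Boxes and Hermitian forms -/

namespace BoxHyp

open Set Filter LinearCocycle

lemma continuous_boxNorm : Continuous boxNorm := by
  unfold boxNorm
  fun_prop

lemma norm_le_two_mul_boxNorm (x : C2) : ‖x‖ ≤ 2 * boxNorm x := by
  have h0 : ∀ i, |(x i).re| ≤ boxNorm x ∧ |(x i).im| ≤ boxNorm x := by
    intro i
    fin_cases i <;> simp [boxNorm]
  refine (pi_norm_le_iff_of_nonneg ?_).2 fun i => ?_
  · linarith [(h0 0).1, abs_nonneg (x 0).re]
  · linarith [Complex.norm_le_abs_re_add_abs_im (x i), h0 i]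

lemma isCompact_box (c : C2) (r : ℝ) : IsCompact (box c r) := by
  refine (isCompact_closedBall c (2 * r)).of_isClosed_subset
    (isClosed_le (continuous_boxNorm.comp (continuous_id.sub continuous_const)) continuous_const)
    fun x hx => ?_
  rw [mem_closedBall_iff_norm]
  have hx' : boxNorm (x - c) ≤ r := hx
  linarith [norm_le_two_mul_boxNorm (x - c)]

lemma subset_nbhd {δ : ℝ} (hδ : 0 < δ) (B : Set C2) : B ⊆ nbhd B δ := fun x hx =>
  ⟨x, hx, by simpa [boxNorm] using hδ⟩

lemma continuous_form (A : Matrix (Fin 2) (Fin 2) ℂ) : Continuous (form A) := by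
  unfold form
  fun_prop

lemma form_smul (A : Matrix (Fin 2) (Fin 2) ℂ) (t : ℂ) (w : C2) :
    form A (t • w) = ‖t‖ ^ 2 * form A w := by
  have h : star t * t = ((‖t‖ ^ 2 : ℝ) : ℂ) := by
    rw [Complex.star_def, Complex.conj_mul', Complex.ofReal_pow]
  rw [form, form, star_smul, Matrix.mulVec_smul, smul_dotProduct, dotProduct_smul, smul_smul, h,
    smul_eq_mul, Complex.re_ofReal_mul]

lemma abs_form_le (A : Matrix (Fin 2) (Fin 2) ℂ) (w : C2) :
    |form A w| ≤ (∑ i, ∑ j, ‖A i j‖) * ‖w‖ ^ 2 := by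
  refine (Complex.abs_re_le_norm _).trans ?_
  simp only [dotProduct, Matrix.mulVec, Finset.sum_mul, Finset.mul_sum]
  refine norm_sum_le_of_le _ fun i _ => norm_sum_le_of_le _ fun j _ => ?_
  rw [norm_mul, norm_mul, Pi.star_apply, norm_star]
  calc ‖w i‖ * (‖A i j‖ * ‖w j‖) ≤ ‖w‖ * (‖A i j‖ * ‖w‖) := by
        gcongr <;> exact norm_le_pi_norm w _
    _ = ‖A i j‖ * ‖w‖ ^ 2 := by ring

/-! ### Derivatives of a polynomial diffeomorphism and its inverse -/

section PolynomialDiffeo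

variable {f : C2 ≃ C2}

lemma IsPolynomialDiffeo.contDiff (hf : IsPolynomialDiffeo f) : ContDiff ℂ ∞ f := by
  obtain ⟨p, hp⟩ := hf.1
  refine contDiff_pi.2 fun i => ?_
  have h := AnalyticOnNhd.eval_mvPolynomial (𝕜 := ℂ) (p i)
  have h2 : (fun x => f x i) = fun x => MvPolynomial.eval x (p i) := funext fun x => hp x i
  rw [h2]
  exact h.contDiff

lemma IsPolynomialDiffeo.continuous_symm (hf : IsPolynomialDiffeo f) : Continuous f.symm :=
  hf.2.continuous

/-- The inverse is only given as real smooth. Its real derivative is a left inverse of the complex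
derivative of f, which is therefore injective, hence invertible; this makes the continuous inverse
complex differentiable. -/
lemma IsPolynomialDiffeo.exists_hasFDerivAt (hf : IsPolynomialDiffeo f) (x : C2) :
    ∃ D : C2 ≃L[ℂ] C2, HasFDerivAt f (D : C2 →L[ℂ] C2) x ∧
      HasFDerivAt f.symm (D.symm : C2 →L[ℂ] C2) (f x) := by
  have h1 : HasFDerivAt f (fderiv ℂ f x) x :=
    (hf.contDiff.differentiable (by simp) x).hasFDerivAt
  have h1r := h1.restrictScalars ℝ
  have h2 : HasFDerivAt f.symm (fderiv ℝ f.symm (f x)) (f x) :=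
    (hf.2.differentiable (by simp) (f x)).hasFDerivAt
  have h3 := HasFDerivAt.comp x h2 h1r
  have h4 : f.symm ∘ f = id := funext f.symm_apply_apply
  rw [h4] at h3
  have hinj : Function.Injective (fderiv ℂ f x) := by
    refine Function.LeftInverse.injective (g := fderiv ℝ f.symm (f x)) fun w => ?_
    exact congrArg (fun L : C2 →L[ℝ] C2 => L w) (h3.unique (hasFDerivAt_id x))
  let D : C2 ≃L[ℂ] C2 := (LinearEquiv.ofInjectiveEndo (fderiv ℂ f x : C2 →ₗ[ℂ] C2)
    hinj).toContinuousLinearEquiv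
  have hD : (D : C2 →L[ℂ] C2) = fderiv ℂ f x := by
    ext1 w
    rfl
  refine ⟨D, hD ▸ h1, ?_⟩
  refine HasFDerivAt.of_local_left_inverse hf.continuous_symm.continuousAt ?_
    (Eventually.of_forall f.apply_symm_apply)
  rw [f.symm_apply_apply]
  exact hD ▸ h1

lemma IsPolynomialDiffeo.fderiv_symm_apply_fderiv (hf : IsPolynomialDiffeo f) (x w : C2) :
    fderiv ℂ f.symm (f x) (fderiv ℂ f x w) = w := by
  obtain ⟨D, h1, h2⟩ := hf.exists_hasFDerivAt x
  rw [h1.fderiv, h2.fderiv]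
  exact D.symm_apply_apply w

lemma IsPolynomialDiffeo.fderiv_apply_fderiv_symm (hf : IsPolynomialDiffeo f) (x w : C2) :
    fderiv ℂ f x (fderiv ℂ f.symm (f x) w) = w := by
  obtain ⟨D, h1, h2⟩ := hf.exists_hasFDerivAt x
  rw [h1.fderiv, h2.fderiv]
  exact D.apply_symm_apply w

lemma IsPolynomialDiffeo.inverse_fderiv_apply (hf : IsPolynomialDiffeo f) (x w : C2) :
    (fderiv ℂ f x).inverse (fderiv ℂ f x w) = w := by
  obtain ⟨D, h1, -⟩ := hf.exists_hasFDerivAt x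
  rw [h1.fderiv, ContinuousLinearMap.inverse_equiv]
  exact D.symm_apply_apply w

lemma IsPolynomialDiffeo.continuous_fderiv (hf : IsPolynomialDiffeo f) :
    Continuous (fderiv ℂ f) :=
  hf.contDiff.continuous_fderiv (by simp)

/-- As a map, the complex derivative of the inverse coincides with the real one, which is
continuous. -/
lemma IsPolynomialDiffeo.continuous_fderiv_symm (hf : IsPolynomialDiffeo f) :
    Continuous (fderiv ℂ f.symm) := by
  refine continuous_clm_apply.2 fun w => ?_
  have h : ∀ y, fderiv ℂ f.symm y w = fderiv ℝ f.symm y w := by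
    intro y
    obtain ⟨x, rfl⟩ := f.surjective y
    obtain ⟨D, -, h2⟩ := hf.exists_hasFDerivAt x
    rw [h2.differentiableAt.fderiv_restrictScalars ℝ]
    rfl
  simp only [h]
  exact (hf.2.continuous_fderiv (by simp)).clm_apply continuous_const

end PolynomialDiffeo

/-! ### Invariance and compactness of the Julia set -/

section JuliaSet

lemma apply_mem_Kplus_iff (f : C2 ≃ C2) (x : C2) : f x ∈ Kplus f ↔ x ∈ Kplus f := by
  have h : (range fun n : ℕ => f^[n] x) = insert x (range fun n : ℕ => f^[n] (f x)) := by
    ext y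
    constructor
    · rintro ⟨n, rfl⟩
      cases n with
      | zero => exact Or.inl rfl
      | succ n => exact Or.inr ⟨n, rfl⟩
    · rintro (rfl | ⟨n, rfl⟩)
      · exact ⟨0, rfl⟩
      · exact ⟨n + 1, rfl⟩
  change Bornology.IsBounded (range fun n : ℕ => f^[n] (f x)) ↔
    Bornology.IsBounded (range fun n : ℕ => f^[n] x)
  rw [h, Bornology.isBounded_insert]

lemma image_juliaSet {f : C2 ≃ C2} (hf : Continuous f) (hf' : Continuous f.symm) :
    f '' juliaSet f = juliaSet f := by
  let F : C2 ≃ₜ C2 := ⟨f, hf, hf'⟩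
  have hK : f '' Kplus f = Kplus f := by
    ext y
    rw [f.image_eq_preimage_symm, mem_preimage, ← apply_mem_Kplus_iff f, f.apply_symm_apply]
  have hK' : f '' Kminus f = Kminus f := by
    ext y
    rw [f.image_eq_preimage_symm, mem_preimage]
    exact apply_mem_Kplus_iff f.symm y
  have h1 : f '' frontier (Kplus f) = frontier (Kplus f) := by
    conv_rhs => rw [← hK]
    exact F.image_frontier _
  have h2 : f '' frontier (Kminus f) = frontier (Kminus f) := by
    conv_rhs => rw [← hK']
    exact F.image_frontier _
  rw [juliaSet, image_inter f.injective, h1, h2]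

lemma isCompact_juliaSet {f : C2 ≃ C2} (Γ : BoxChainModel f (juliaSet f)) :
    IsCompact (juliaSet f) :=
  (isCompact_iUnion fun k => isCompact_box (Γ.center k) (Γ.radius k)).of_isClosed_subset
    (isClosed_frontier.inter isClosed_frontier) Γ.covers

end JuliaSet

/-! ### From cone conditions to a Lyapunov function -/

/-- The two cone conditions together say that `Df` increases the forms on all nonzero vectors. -/
lemma form_lt_form_apply {f : C2 ≃ C2} (hf : IsPolynomialDiffeo f)
    {A A' : Matrix (Fin 2) (Fin 2) ℂ} {z : C2}
    (hu : ∀ w ∈ unstableCone A, w ≠ 0 → fderiv ℂ f z w ∈ unstableCone A' ∧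
      form A w < form A' (fderiv ℂ f z w))
    (hs : ∀ v ∈ stableCone A', (fderiv ℂ f z).inverse v ∈ stableCone A ∧
      -form A' v < -form A ((fderiv ℂ f z).inverse v)) {w : C2} (hw : w ≠ 0) :
    form A w < form A' (fderiv ℂ f z w) := by
  by_cases h1 : w ∈ unstableCone A
  · exact (hu w h1 hw).2
  -- A vector passing from the stable to the unstable cone goes from a negative to a nonnegative
  -- value.
  by_cases h2 : fderiv ℂ f z w ∈ unstableCone A'
  · exact (not_le.1 h1).trans_le h2
  · have h3 := (hs _ h2).2
    rw [hf.inverse_fderiv_apply] at h3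
    exact neg_lt_neg_iff.1 h3

/-- The gain has a positive minimum on the compact product of `B` with the unit sphere; homogeneity
extends it to all vectors. -/
lemma exists_increase {f : C2 ≃ C2} (hf : IsPolynomialDiffeo f)
    {A A' : Matrix (Fin 2) (Fin 2) ℂ} {B : Set C2} (hB : IsCompact B)
    (h : ∀ z ∈ B, ∀ w, w ≠ 0 → form A w < form A' (fderiv ℂ f z w)) :
    ∃ c > 0, ∀ z ∈ B, ∀ w, form A w + c * ‖w‖ ^ 2 ≤ form A' (fderiv ℂ f z w) := by
  have hD : Continuous fun p : C2 × C2 => fderiv ℂ f p.1 p.2 :=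
    (hf.continuous_fderiv.comp continuous_fst).clm_apply continuous_snd
  have hcont : Continuous fun p : C2 × C2 => form A' (fderiv ℂ f p.1 p.2) - form A p.2 :=
    ((continuous_form A').comp hD).sub ((continuous_form A).comp continuous_snd)
  have hpos : ∀ p ∈ B ×ˢ Metric.sphere (0 : C2) 1,
      0 < form A' (fderiv ℂ f p.1 p.2) - form A p.2 := by
    rintro ⟨z, w⟩ ⟨hz, hw⟩
    refine sub_pos.2 (h z hz w ?_)
    rintro rfl
    simp at hw
  obtain ⟨c, hc, hle⟩ :=
    (hB.prod (isCompact_sphere (0 : C2) 1)).exists_forall_le' hcont.continuousOn hpos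
  refine ⟨c, hc, fun z hz w => ?_⟩
  rcases eq_or_ne w 0 with rfl | hw0
  · simp [form]
  have hn : 0 < ‖w‖ := norm_pos_iff.2 hw0
  have h1 := hle (z, ((‖w‖⁻¹ : ℝ) : ℂ) • w) ⟨hz, by simp [norm_smul, hw0]⟩
  simp only [map_smul, form_smul, Complex.norm_real, norm_inv, norm_norm] at h1
  rw [← mul_sub, inv_pow, inv_mul_eq_div, le_div_iff₀ (by positivity)] at h1
  linarith

lemma exists_pos_forall_of_antitone {ι : Type*} [Finite ι] {p : ι → ℝ → Prop}
    (hp : ∀ i c c', c' ≤ c → p i c → p i c') (h : ∀ i, ∃ c > 0, p i c) :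
    ∃ c > 0, ∀ i, p i c := by
  have h1 : ∀ᶠ c in 𝓝[>] (0 : ℝ), ∀ i, p i c := eventually_all.2 fun i => by
    obtain ⟨c, hc, hpc⟩ := h i
    filter_upwards [Ioo_mem_nhdsGT hc] with c' hc' using hp i c c' hc'.2.le hpc
  obtain ⟨c, hc, hc0⟩ := (h1.and self_mem_nhdsWithin).exists
  exact ⟨c, hc0, hc⟩

/-- If v = Df⁻¹ w then ‖w‖ ≤ a‖v‖, so the gain c‖v‖² is at least (c / a²)‖w‖². -/
lemma isLyapunov_symm {f : C2 ≃ C2} (hf : IsPolynomialDiffeo f) {J : Set C2} (hfJ : f '' J = J)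
    {q : C2 → C2 → ℝ} {c M a : ℝ} (h : IsLyapunov f (fderiv ℂ f) J q c M) (ha : 1 ≤ a)
    (hbound : ∀ x ∈ J, ‖fderiv ℂ f x‖ ≤ a) :
    IsLyapunov f.symm (fderiv ℂ f.symm) J (fun x w => -q x w) (c / a ^ 2) M where
  pos := div_pos h.pos (by positivity)
  lt := (div_le_self h.pos.le (one_le_pow₀ ha)).trans_lt h.lt
  mapsTo := by
    intro x hx
    rw [← hfJ] at hx
    obtain ⟨y, hy, rfl⟩ := hx
    rwa [f.symm_apply_apply]
  bound := fun x hx w => by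
    rw [abs_neg]
    exact h.bound x hx w
  increase := by
    intro x hx w
    rw [← hfJ] at hx
    obtain ⟨y, hy, rfl⟩ := hx
    rw [f.symm_apply_apply]
    set v := fderiv ℂ f.symm (f y) w with hv
    have hw : fderiv ℂ f y v = w := hf.fderiv_apply_fderiv_symm y w
    have h1 := h.increase y hy v
    have h2 : ‖w‖ ≤ a * ‖v‖ := by
      rw [← hw]
      exact (fderiv ℂ f y).le_of_opNorm_le (hbound y hy) v
    have h3 : c / a ^ 2 * ‖w‖ ^ 2 ≤ c / a ^ 2 * (a * ‖v‖) ^ 2 :=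
      mul_le_mul_of_nonneg_left (pow_le_pow_left₀ (norm_nonneg w) h2 2)
        (div_pos h.pos (by positivity)).le
    have h4 : c / a ^ 2 * (a * ‖v‖) ^ 2 = c * ‖v‖ ^ 2 := by
      field_simp
    rw [hw] at h1
    linarith

/-- A box hyperbolic model provides a Lyapunov function for the derivative cocycle: at every point
of the Julia set, the form of some box that contains the point. -/
lemma BoxChainModel.IsBoxHyperbolic.exists_isLyapunov {f : C2 ≃ C2} (hf : IsPolynomialDiffeo f)
    (hfJ : f '' juliaSet f = juliaSet f) {Γ : BoxChainModel f (juliaSet f)}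
    (hΓ : Γ.IsBoxHyperbolic) :
    ∃ (A : C2 → Matrix (Fin 2) (Fin 2) ℂ) (c M : ℝ),
      (∀ x ∈ juliaSet f, IsIndefiniteHermitian (A x)) ∧
      IsLyapunov f (fderiv ℂ f) (juliaSet f) (fun x => form (A x)) c M := by
  obtain ⟨Q, hQ, hcone⟩ := hΓ
  obtain ⟨δ, hδ, hedge⟩ := Γ.has_edges
  obtain ⟨c, hc, hinc⟩ := exists_pos_forall_of_antitone (ι := Fin Γ.N × Fin Γ.N)
    (p := fun i c => Γ.graph.Adj i.1 i.2 → ∀ z ∈ Γ.B i.1, ∀ w,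
      form (Q i.1) w + c * ‖w‖ ^ 2 ≤ form (Q i.2) (fderiv ℂ f z w))
    (fun i c c' hcc hp hadj z hz w => by
      have h1 := hp hadj z hz w
      have h2 := mul_le_mul_of_nonneg_right hcc (sq_nonneg ‖w‖)
      linarith)
    (fun i => by
      by_cases hadj : Γ.graph.Adj i.1 i.2
      · obtain ⟨c, hc, h⟩ := exists_increase hf (isCompact_box (Γ.center i.1) (Γ.radius i.1))
          fun z hz w hw => form_lt_form_apply hf (hcone _ _ hadj z hz).1 (hcone _ _ hadj z hz).2 hw
        exact ⟨c, hc, fun _ => h⟩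
      · exact ⟨1, one_pos, fun h => (hadj h).elim⟩)
  have hbox : ∀ x ∈ juliaSet f, ∃ A, ∃ k, x ∈ Γ.B k ∧ A = Q k := fun x hx => by
    obtain ⟨k, hk⟩ := mem_iUnion.1 (Γ.covers hx)
    exact ⟨Q k, k, hk, rfl⟩
  -- Where boxes touch, the choice is arbitrary: the increase holds along every edge.
  choose! A hA using hbox
  have hmaps : MapsTo f (juliaSet f) (juliaSet f) := fun x hx => hfJ ▸ mem_image_of_mem f hx
  have hsum : 0 ≤ ∑ k, ∑ i, ∑ j, ‖Q k i j‖ := by positivity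
  -- M dominates every form and exceeds c.
  refine ⟨A, c, c + 1 + ∑ k, ∑ i, ∑ j, ‖Q k i j‖, fun x hx => ?_, hc, by linarith, hmaps, ?_, ?_⟩
  · obtain ⟨k, -, hk⟩ := hA x hx
    exact hk ▸ hQ k
  · intro x hx w
    obtain ⟨k, -, hk⟩ := hA x hx
    rw [hk]
    refine (abs_form_le (Q k) w).trans (mul_le_mul_of_nonneg_right ?_ (sq_nonneg _))
    have h1 := Finset.single_le_sum (f := fun k => ∑ i, ∑ j, ‖Q k i j‖)
      (fun k _ => by positivity) (Finset.mem_univ k)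
    linarith
  · intro x hx w
    obtain ⟨k, hxk, hk⟩ := hA x hx
    obtain ⟨j, hxj, hj⟩ := hA (f x) (hmaps hx)
    rw [hk, hj]
    exact hinc (k, j) (hedge k j ⟨f x, mem_image_of_mem f hxk, subset_nbhd hδ _ hxj⟩) x hxk w

lemma BoxChainModel.IsBoxHyperbolic.isHyperbolicOn_juliaSet {f : C2 ≃ C2}
    (hf : IsPolynomialDiffeo f) {Γ : BoxChainModel f (juliaSet f)} (hΓ : Γ.IsBoxHyperbolic) :
    IsHyperbolicOn f (juliaSet f) := by
  have hfc : Continuous f := hf.contDiff.continuous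
  have hJ := isCompact_juliaSet Γ
  have hfJ := image_juliaSet hfc hf.continuous_symm
  obtain ⟨A, c, M, hA, h⟩ := hΓ.exists_isLyapunov hf hfJ
  obtain ⟨a, ha⟩ := hJ.exists_bound_of_continuousOn hf.continuous_fderiv.continuousOn
  have h' := isLyapunov_symm hf hfJ h (le_max_right a 1)
    fun x hx => (ha x hx).trans (le_max_left a 1)
  -- Both cocycles must share one constant, so the forward one is weakened to that of the inverse.
  have hc : c / max a 1 ^ 2 ≤ c := div_le_self h.pos.le (one_le_pow₀ (le_max_right a 1))
  exact ⟨hJ, hfJ, exists_hyperbolic_splitting hfc hf.continuous_symm hf.continuous_fderiv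
    hf.continuous_fderiv_symm hJ (h.mono h'.pos hc) h' (by simp)
    hf.fderiv_apply_fderiv_symm hf.fderiv_symm_apply_fderiv (fun x => continuous_form (A x))
    (fun x => form_smul (A x)) (fun x hx => (hA x hx).2.2.2) fun x hx => (hA x hx).2.2.1⟩

end BoxHyp

end

theorem theorem1p2 (f : BoxHyp.C2 ≃ BoxHyp.C2) (hf : BoxHyp.IsPolynomialDiffeo f)
    (d : ℝ) (hd : BoxHyp.HasDynamicalDegree f d) (hd1 : 1 < d)
    (Γ : BoxHyp.BoxChainModel f (BoxHyp.juliaSet f)) (hΓ : Γ.IsBoxHyperbolic) :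
    BoxHyp.IsHyperbolicOn f (BoxHyp.juliaSet f) :=
  hΓ.isHyperbolicOn_juliaSet hf
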